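/- For $b\in\mathbb{C}$ let $p_b(z)=z^3+6z+b$, and let $H_b$ be Halley's method applied to $p_b$, i.e. the rational self-map of the Riemann sphere $\widehat{\mathbb{C}}=\mathbb{C}\cup\{\infty\}$ given by $$H_b(z)=z-\frac{2p_b(z)p_b'(z)}{2p_b'(z)^2-p_b(z)p_b''(z)} .$$ The Fatou set $\mathcal{F}(H_b)$ is the set of points of $\widehat{\mathbb{C}}$ having a neighbourhood on which the family of iterates $\{H_b^n\}_{n\ge 0}$ is normal, and a Fatou component is a connected component of $\mathcal{F}(H_b)$. A Fatou component $U$ is a Siegel disk (respectively a Herman ring) if there are an integer $k\ge 1$ with $H_b^k(U)\subseteq U$, an irrational number $\theta$, and an analytic homeomorphism $\phi$ from $U$ onto $\{z\in\mathbb{C}:|z|<1\}$ (respectively onto $\{z\in\mathbb{C}:1<|z|<r\}$ for some real $r>1$) such that $\phi\circ H_b^k\circ\phi^{-1}(z)=e^{2\pi i\theta}z$ for all $z$ in the image of $\phi$. A rotation domain is a Fatou component that is a Siegel disk or a Herman ring. If $b$ is real, then $H_b$ has no rotation domain. -/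

import Mathlib

open Polynomial

noncomputable section

namespace HalleyDynamics

/-- The extended complex plane `ℂ ∪ {∞}`, with the topology of the one-point compactification. -/
abbrev Sphere : Type := OnePoint ℂ

/-- The self-map of the sphere given by a rational function in lowest terms `P / Q`.
Poles are sent to `∞`. With `d = max (deg P) (deg Q)`, the value at `∞` is the quotient of the
coefficients of degree `d` of `P` and `Q`, read as `∞` if that of `Q` vanishes. -/
def ratMap (R : RatFunc ℂ) : Sphere → Sphere
  | OnePoint.some z =>
      if R.denom.eval z = 0 then OnePoint.infty
      else OnePoint.some (R.num.eval z / R.denom.eval z)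
  | OnePoint.infty =>
      let d := max R.num.natDegree R.denom.natDegree
      if R.denom.coeff d = 0 then OnePoint.infty
      else OnePoint.some (R.num.coeff d / R.denom.coeff d)

/-- Halley's method `z - 2 p p' / (2 p'² - p p'')` as a rational function. -/
def halley (p : ℂ[X]) : RatFunc ℂ :=
  RatFunc.X -
    algebraMap ℂ[X] (RatFunc ℂ) (2 * p * derivative p) /
      algebraMap ℂ[X] (RatFunc ℂ)
        (2 * derivative p ^ 2 - p * derivative (derivative p))

/-- The cubic polynomial `z³ + 6 z + b`. -/
def cubic (b : ℂ) : ℂ[X] := X ^ 3 + 6 * X + C b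

/-- A family of self-maps of the sphere is normal on `V` if every sequence in it has a subsequence
converging locally uniformly on `V`. Uniformity is that of the compact Hausdorff sphere (its unique
compatible uniform structure, which is that of the spherical metric). -/
def IsNormalOn (F : Set (Sphere → Sphere)) (V : Set Sphere) : Prop :=
  letI : UniformSpace Sphere := uniformSpaceOfCompactR1
  ∀ f : ℕ → Sphere → Sphere, (∀ n, f n ∈ F) →
    ∃ s : ℕ → ℕ, StrictMono s ∧ ∃ g : Sphere → Sphere,
      TendstoLocallyUniformlyOn (fun n => f (s n)) g Filter.atTop V

/-- The Fatou set: points near which the family of iterates is normal. -/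
def fatouSet (R : Sphere → Sphere) : Set Sphere :=
  {z | ∃ V : Set Sphere, IsOpen V ∧ z ∈ V ∧ IsNormalOn (Set.range fun n : ℕ => R^[n]) V}

/-- `U` is a connected component of the Fatou set. -/
def IsFatouComponent (R : Sphere → Sphere) (U : Set Sphere) : Prop :=
  ∃ z ∈ fatouSet R, U = connectedComponentIn (fatouSet R) z

/-- The inverse of the chart `z ↦ 1 / z` at `∞`. -/
def chartInfty (w : ℂ) : Sphere := if w = 0 then OnePoint.infty else OnePoint.some w⁻¹

/-- A complex-valued function is holomorphic on the open subset `U` of the sphere if it is so in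
both of the standard charts `z` and `1 / z`. -/
def HolomorphicOn (φ : Sphere → ℂ) (U : Set Sphere) : Prop :=
  DifferentiableOn ℂ (fun z : ℂ => φ (OnePoint.some z)) {z : ℂ | OnePoint.some z ∈ U} ∧
    DifferentiableOn ℂ (fun w : ℂ => φ (chartInfty w)) {w : ℂ | chartInfty w ∈ U}

/-- `S` maps `U` into itself and some analytic homeomorphism from `U` onto `W ⊆ ℂ` conjugates
`S` on `U` to an irrational rotation. -/
def IsConjToIrrationalRotation (S : Sphere → Sphere) (U : Set Sphere) (W : Set ℂ) : Prop :=
  Set.MapsTo S U U ∧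
    ∃ φ : OpenPartialHomeomorph Sphere ℂ, φ.source = U ∧ φ.target = W ∧ HolomorphicOn φ U ∧
      ∃ θ : ℝ, Irrational θ ∧
        ∀ z ∈ W, φ (S (φ.symm z)) = Complex.exp (2 * Real.pi * Complex.I * θ) * z

/-- A (periodic) Siegel disk: a Fatou component on which some iterate `R^k`, `k ≥ 1`, is
conjugate to an irrational rotation of the unit disk. -/
def IsSiegelDisk (R : Sphere → Sphere) (U : Set Sphere) : Prop :=
  IsFatouComponent R U ∧
    ∃ k : ℕ, 1 ≤ k ∧ IsConjToIrrationalRotation R^[k] U {z : ℂ | ‖z‖ < 1}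

/-- A (periodic) Herman ring: a Fatou component on which some iterate `R^k`, `k ≥ 1`, is
conjugate to an irrational rotation of a round annulus. -/
def IsHermanRing (R : Sphere → Sphere) (U : Set Sphere) : Prop :=
  IsFatouComponent R U ∧
    ∃ k : ℕ, 1 ≤ k ∧ ∃ r : ℝ, 1 < r ∧
      IsConjToIrrationalRotation R^[k] U {z : ℂ | 1 < ‖z‖ ∧ ‖z‖ < r}

/-- A rotation domain is a Siegel disk or a Herman ring. -/
def IsRotationDomain (R : Sphere → Sphere) (U : Set Sphere) : Prop :=
  IsSiegelDisk R U ∨ IsHermanRing R U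

end HalleyDynamics

end

open Filter Metric Set Polynomial
open scoped Topology

namespace HalleyDynamics

/-- Locally uniform convergence on an open set follows from continuous convergence. -/
theorem tendstoLocallyUniformlyOn_of_tendsto_prod {ι α β : Type*} [TopologicalSpace α]
    [UniformSpace β] {F : ι → α → β} {f : α → β} {p : Filter ι} {s : Set α} (hs : IsOpen s)
    (hf : ContinuousOn f s)
    (h : ∀ x ∈ s, Tendsto (fun y : ι × α => F y.1 y.2) (p ×ˢ 𝓝 x) (𝓝 (f x))) :
    TendstoLocallyUniformlyOn F f p s := by
  rw [hs.tendstoLocallyUniformlyOn_iff_forall_tendsto]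
  intro x hx
  have h1 : Tendsto (fun y : ι × α => f y.2) (p ×ˢ 𝓝 x) (𝓝 (f x)) :=
    (hf.continuousAt (hs.mem_nhds hx)).tendsto.comp tendsto_snd
  exact ((h1.prodMk_nhds (h x hx))).mono_right (nhds_le_uniformity _)

/-- Cauchy's estimate for the Taylor coefficients of a bounded function on a ball. -/
theorem norm_taylorCoeff_le {f : ℂ → ℂ} {c : ℂ} {R ρ M : ℝ} (hρ : 0 < ρ) (hρR : ρ < R)
    (hd : DifferentiableOn ℂ f (ball c R)) (hb : ∀ z ∈ ball c R, ‖f z‖ ≤ M) (k : ℕ) :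
    ‖(k.factorial : ℂ)⁻¹ * iteratedDeriv k f c‖ ≤ M / ρ ^ k := by
  have h1 : DiffContOnCl ℂ f (ball c ρ) := by
    apply DifferentiableOn.diffContOnCl
    rw [closure_ball c hρ.ne']
    exact hd.mono (closedBall_subset_ball hρR)
  have h2 := Complex.norm_iteratedDeriv_le_of_forall_mem_sphere_norm_le k hρ h1
    (fun z hz => hb z (closedBall_subset_ball hρR (sphere_subset_closedBall hz)))
  have hk : (0 : ℝ) < k.factorial := by exact_mod_cast k.factorial_pos
  rw [norm_mul, norm_inv, Complex.norm_natCast, inv_mul_le_iff₀ hk]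
  calc _ ≤ _ := h2
    _ = _ := by ring

theorem hasSum_taylorCoeff {f : ℂ → ℂ} {c z : ℂ} {R : ℝ}
    (hd : DifferentiableOn ℂ f (ball c R)) (hz : z ∈ ball c R) :
    HasSum (fun k : ℕ => (k.factorial : ℂ)⁻¹ * iteratedDeriv k f c * (z - c) ^ k) (f z) := by
  have := Complex.hasSum_taylorSeries_on_ball hd hz
  refine this.congr_fun ?_ 
  intro k
  simp only [smul_eq_mul]
  ring

/-- **Montel's theorem** for uniformly bounded sequences on a ball. -/
theorem exists_subseq_tendsto_of_bounded {f : ℕ → ℂ → ℂ} {c : ℂ} {R M : ℝ} (hR : 0 < R)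
    (hd : ∀ n, DifferentiableOn ℂ (f n) (ball c R))
    (hb : ∀ n, ∀ z ∈ ball c R, ‖f n z‖ ≤ M) :
    ∃ s : ℕ → ℕ, StrictMono s ∧ ∃ g : ℂ → ℂ, ContinuousOn g (ball c R) ∧
      ∀ z ∈ ball c R,
        Tendsto (fun y : ℕ × ℂ => f (s y.1) y.2) (atTop ×ˢ 𝓝 z) (𝓝 (g z)) := by
  set A : ℕ → ℕ → ℂ := fun n k => (k.factorial : ℂ)⁻¹ * iteratedDeriv k (f n) c with hA
  have hAb : ∀ ρ, 0 < ρ → ρ < R → ∀ n k, ‖A n k‖ ≤ M / ρ ^ k := fun ρ h0 h1 n k =>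
    norm_taylorCoeff_le h0 h1 (hd n) (hb n) k
  have hcomp : IsCompact (Set.univ.pi fun k : ℕ => closedBall (0 : ℂ) (M / (R / 2) ^ k)) :=
    isCompact_univ_pi fun k => isCompact_closedBall _ _
  obtain ⟨a, -, s, hs, hlim⟩ := hcomp.tendsto_subseq (x := A) (fun n k _ => by
    simpa using hAb (R / 2) (by linarith) (by linarith) n k)
  have hlim' : ∀ k, Tendsto (fun n => A (s n) k) atTop (𝓝 (a k)) := fun k =>
    (tendsto_pi_nhds.1 hlim) k
  have hab : ∀ ρ, 0 < ρ → ρ < R → ∀ k, ‖a k‖ ≤ M / ρ ^ k := fun ρ h0 h1 k =>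
    le_of_tendsto (hlim' k).norm (Eventually.of_forall fun n => hAb ρ h0 h1 (s n) k)
  have key : ∀ z ∈ ball c R, ∃ bound : ℕ → ℝ, Summable bound ∧
      ∃ V ∈ 𝓝 z, V ⊆ ball c R ∧ ∀ y ∈ V, ∀ (u : ℕ → ℂ),
        (∀ ρ, 0 < ρ → ρ < R → ∀ k, ‖u k‖ ≤ M / ρ ^ k) →
          ∀ k, ‖u k * (y - c) ^ k‖ ≤ bound k := by
    intro z hz
    rw [mem_ball, dist_eq_norm] at hz
    obtain ⟨ρ₁, h1, h1'⟩ := exists_between hz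
    obtain ⟨ρ, h2, h2'⟩ := exists_between h1'
    have hρ₁ : 0 < ρ₁ := (norm_nonneg _).trans_lt h1
    have hρ : 0 < ρ := hρ₁.trans h2
    refine ⟨fun k => M * (ρ₁ / ρ) ^ k, (summable_geometric_of_lt_one (by positivity)
      ((div_lt_one hρ).2 h2)).mul_left _, ball c ρ₁, isOpen_ball.mem_nhds ?_,
      ball_subset_ball h1'.le, fun y hy u hu k => ?_⟩
    · rwa [mem_ball, dist_eq_norm]
    · rw [mem_ball, dist_eq_norm] at hy
      rw [norm_mul, norm_pow]
      calc ‖u k‖ * ‖y - c‖ ^ k ≤ M / ρ ^ k * ρ₁ ^ k := by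
            gcongr
            · exact (norm_nonneg _).trans (hu ρ hρ h2' k)
            · exact hu ρ hρ h2' k
        _ = M * (ρ₁ / ρ) ^ k := by rw [div_pow]; ring
  refine ⟨s, hs, fun z => ∑' k, a k * (z - c) ^ k, fun z hz => ?_, fun z hz => ?_⟩
  · obtain ⟨bound, hsum, V, hV, -, hVb⟩ := key z hz
    refine ContinuousAt.continuousWithinAt ?_
    refine tendsto_tsum_of_dominated_convergence (bound := bound) hsum (fun k => ?_) ?_
    · exact Continuous.tendsto (by fun_prop) z
    · filter_upwards [hV] with y hy k using hVb y hy a hab k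
  · obtain ⟨bound, hsum, V, hV, hVR, hVb⟩ := key z hz
    have h := tendsto_tsum_of_dominated_convergence (𝓕 := (atTop : Filter ℕ) ×ˢ 𝓝 z)
      (f := fun (y : ℕ × ℂ) k => A (s y.1) k * (y.2 - c) ^ k)
      (g := fun k => a k * (z - c) ^ k) (bound := bound) hsum (fun k => ?_) ?_
    · refine h.congr' ?_
      filter_upwards [tendsto_snd.eventually hV] with y hy
      exact (hasSum_taylorCoeff (hd _) (hVR hy)).tsum_eq
    · refine ((hlim' k).comp tendsto_fst).mul ?_
      exact (Continuous.tendsto (f := fun y : ℂ => (y - c) ^ k) (by fun_prop) z).comp tendsto_snd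
    · filter_upwards [tendsto_snd.eventually hV] with y hy k
      exact hVb _ hy _ (fun ρ h0 h1 k => hAb ρ h0 h1 _ k) k

end HalleyDynamics

namespace HalleyDynamics

/-- The points whose first `n` iterates under `G` avoid the set `Z` of poles. -/
def regularSet (G : ℂ → ℂ) (Z : Set ℂ) (n : ℕ) : Set ℂ := {w | ∀ i < n, G^[i] w ∉ Z}

/-- `G` is holomorphic off the closed set `Z`, and proper as a map from `ℂ \ Z` to `ℂ`. -/
structure IsProperHolomorphic (G : ℂ → ℂ) (Z : Set ℂ) : Prop where
  isClosed : IsClosed Z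
  differentiableOn : DifferentiableOn ℂ G Zᶜ
  isCompact_preimage : ∀ K, IsCompact K → IsCompact (Zᶜ ∩ G ⁻¹' K)

variable {G : ℂ → ℂ} {Z : Set ℂ}

theorem mem_regularSet_succ {n : ℕ} {w : ℂ} :
    w ∈ regularSet G Z (n + 1) ↔ w ∉ Z ∧ G w ∈ regularSet G Z n := by
  constructor
  · intro h
    exact ⟨h 0 n.succ_pos, fun i hi => by
      have := h (i + 1) (by omega)
      rwa [Function.iterate_succ_apply] at this⟩
  · rintro ⟨h0, h1⟩ i hi
    cases i with
    | zero => exact h0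
    | succ i => rw [Function.iterate_succ_apply]; exact h1 i (by omega)

theorem regularSet_succ (n : ℕ) :
    regularSet G Z (n + 1) = Zᶜ ∩ G ⁻¹' regularSet G Z n := by
  ext w; exact mem_regularSet_succ

theorem regularSet_zero : regularSet G Z 0 = univ := by
  ext w; simp [regularSet]

theorem regularSet_anti {m n : ℕ} (h : m ≤ n) : regularSet G Z n ⊆ regularSet G Z m :=
  fun _ hw i hi => hw i (hi.trans_le h)

namespace IsProperHolomorphic

theorem isOpen_regularSet (h : IsProperHolomorphic G Z) (n : ℕ) : IsOpen (regularSet G Z n) := by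
  induction n with
  | zero => rw [regularSet_zero]; exact isOpen_univ
  | succ n ih =>
    rw [regularSet_succ]
    exact h.differentiableOn.continuousOn.isOpen_inter_preimage h.isClosed.isOpen_compl ih

theorem differentiableOn_iterate (h : IsProperHolomorphic G Z) (n : ℕ) :
    DifferentiableOn ℂ G^[n] (regularSet G Z n) := by
  induction n with
  | zero => exact differentiableOn_id
  | succ n ih =>
    rw [Function.iterate_succ, regularSet_succ]
    exact ih.comp (h.differentiableOn.mono inter_subset_left) fun w hw => hw.2

theorem isCompact_preimage_iterate (h : IsProperHolomorphic G Z) (n : ℕ) {K : Set ℂ}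
    (hK : IsCompact K) :
    IsCompact (regularSet G Z n ∩ G^[n] ⁻¹' K) := by
  induction n with
  | zero => simpa [regularSet_zero] using hK
  | succ n ih =>
    convert h.isCompact_preimage _ ih using 1
    rw [regularSet_succ, Function.iterate_succ, preimage_comp, preimage_inter, inter_assoc]

theorem hasStrictDerivAt_iterate (h : IsProperHolomorphic G Z) {n : ℕ} {w : ℂ}
    (hw : w ∈ regularSet G Z n) :
    HasStrictDerivAt G^[n] (deriv G^[n] w) w :=
  ((h.differentiableOn_iterate n).analyticAt
    ((h.isOpen_regularSet n).mem_nhds hw)).hasStrictDerivAt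

/-- Over a ball without critical values of `G^[n]`, the iterate `G^[n]` has a holomorphic right
inverse through every given preimage. -/
theorem exists_inverse_branch (h : IsProperHolomorphic G Z) {n : ℕ} {c : ℂ} {ε : ℝ} (hε : 0 < ε)
    (hcrit : ∀ w ∈ regularSet G Z n, G^[n] w ∈ ball c ε → deriv G^[n] w ≠ 0)
    {a : ℂ} (ha : a ∈ regularSet G Z n) (hab : G^[n] a ∈ ball c ε) :
    ∃ g : ℂ → ℂ, DifferentiableOn ℂ g (ball c ε) ∧ g (G^[n] a) = a ∧
      ∀ w ∈ ball c ε, g w ∈ regularSet G Z n ∧ G^[n] (g w) = w := by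
  classical
  set f : regularSet G Z n → ℂ := (regularSet G Z n).domRestrict G^[n] with hf
  have hfc : Continuous f := (h.differentiableOn_iterate n).continuousOn.domRestrict
  have hlh : IsLocalHomeomorphOn f (f ⁻¹' ball c ε) := by
    have h1 : IsLocalHomeomorphOn G^[n] (regularSet G Z n ∩ G^[n] ⁻¹' ball c ε) := by
      intro w hw
      have hs := (h.hasStrictDerivAt_iterate hw.1).hasStrictFDerivAt_equiv (hcrit w hw.1 hw.2)
      exact ⟨hs.toOpenPartialHomeomorph _, hs.mem_toOpenPartialHomeomorph_source,
        (hs.toOpenPartialHomeomorph_coe).symm⟩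
    exact h1.comp ((h.isOpen_regularSet n).isOpenEmbedding_subtypeVal.isLocalHomeomorph
      |>.isLocalHomeomorphOn (s := f ⁻¹' ball c ε))
      fun w hw => ⟨w.2, hw⟩
  have hpre : ∀ K, IsCompact K → IsCompact (f ⁻¹' K) := by
    intro K hK
    rw [Subtype.isCompact_iff]
    convert h.isCompact_preimage_iterate n hK using 1
    ext w
    simp [hf, and_comm]
  have hprop : IsProperMap f := isProperMap_iff_isCompact_preimage.2 ⟨hfc, fun {K} hK => hpre K hK⟩
  have hcov : IsCoveringMapOn f (ball c ε) := by
    refine hprop.isClosedMap.isCoveringMapOn_of_isLocalHomeomorphOn (fun x hx => ?_) hlh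
    refine (hpre _ isCompact_singleton).finite (.of_openPartialHomeomorph f subset_rfl ?_)
    intro e he
    obtain ⟨ψ, hψ, hψf⟩ := hlh e (by rw [mem_preimage, mem_singleton_iff.1 he]; exact hx)
    exact ⟨ψ, hψ, hψf.symm⟩
  have : ContractibleSpace (ball c ε) :=
    (convex_ball c ε).contractibleSpace ⟨c, mem_ball_self hε⟩
  have : LocallyPathConnectedSpace (ball c ε) := isOpen_ball.locallyPathConnectedSpace
  obtain ⟨F, ⟨hFa, hFf⟩, -⟩ := hcov.existsUnique_continuousMap_lifts
    (⟨Subtype.val, continuous_subtype_val⟩ : C(ball c ε, ℂ)) (a₀ := ⟨G^[n] a, hab⟩)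
    (e₀ := ⟨a, ha⟩) rfl (fun x => x.2)
  set g : ℂ → ℂ := fun w => if hw : w ∈ ball c ε then (F ⟨w, hw⟩ : ℂ) else 0 with hg
  have hgF : ∀ w (hw : w ∈ ball c ε), g w = F ⟨w, hw⟩ := fun w hw => by simp only [hg, dif_pos hw]
  have hinv : ∀ w ∈ ball c ε, g w ∈ regularSet G Z n ∧ G^[n] (g w) = w := by
    intro w hw
    rw [hgF w hw]
    exact ⟨(F ⟨w, hw⟩).2, congrFun hFf ⟨w, hw⟩⟩
  have hgc : ContinuousOn g (ball c ε) := by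
    rw [continuousOn_iff_continuous_domRestrict]
    have : (ball c ε).domRestrict g = fun w => (F w : ℂ) := by
      funext w; exact hgF w w.2
    rw [this]
    fun_prop
  refine ⟨g, fun w hw => ?_, by rw [hgF _ hab, hFa], hinv⟩
  have hnhds := isOpen_ball.mem_nhds hw
  obtain ⟨hw1, hw2⟩ := hinv w hw
  refine (HasDerivAt.of_local_left_inverse (hgc.continuousAt hnhds)
    (h.hasStrictDerivAt_iterate hw1).hasDerivAt (hcrit _ hw1 (by rwa [hw2])) ?_
    ).differentiableAt.differentiableWithinAt
  filter_upwards [hnhds] with y hy using (hinv y hy).2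

/-- A right inverse of `G^[n]` that inverts `G^[n]` at one point inverts it on a ball around it. -/
theorem leftInvOn_ball (h : IsProperHolomorphic G Z) {n : ℕ} {D : Set ℂ} {g : ℂ → ℂ}
    (hg : DifferentiableOn ℂ g D) (hinv : ∀ w ∈ D, G^[n] (g w) = w) {a : ℂ} {η : ℝ}
    (hη : 0 < η) (hreg : ball a η ⊆ regularSet G Z n) (hmaps : MapsTo G^[n] (ball a η) D)
    (hga : g (G^[n] a) = a) (hcrit : deriv G^[n] a ≠ 0) :
    LeftInvOn g G^[n] (ball a η) := by
  have ha := mem_ball_self (x := a) hη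
  have hF := (h.differentiableOn_iterate n).mono hreg
  have hcomp : DifferentiableOn ℂ (g ∘ G^[n]) (ball a η) := hg.comp hF hmaps
  refine (hcomp.analyticOnNhd isOpen_ball).eqOn_of_preconnected_of_eventuallyEq (g := id)
    (fun z _ => analyticAt_id) (convex_ball a η).isPreconnected ha ?_
  have hs := (h.hasStrictDerivAt_iterate (hreg ha)).hasStrictFDerivAt_equiv hcrit
  set e := hs.toOpenPartialHomeomorph G^[n] with he
  have hsrc : e.source ∈ 𝓝 a := e.open_source.mem_nhds hs.mem_toOpenPartialHomeomorph_source
  have hball := isOpen_ball.mem_nhds ha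
  have hcont : Tendsto (g ∘ G^[n]) (𝓝 a) (𝓝 a) := by
    have := (hcomp.continuousOn.continuousAt hball).tendsto
    simpa only [Function.comp_apply, hga] using this
  filter_upwards [hsrc, hcont hsrc, hball] with y hy1 hy2 hy3
  exact e.injOn hy2 hy1 (hinv _ (hmaps hy3))

theorem lt_norm_iterate_add {ρ M : ℝ} (hesc : ∀ w, w ∉ Z → ρ ≤ ‖w‖ → ‖w‖ ≤ ‖G w‖) (hM : ρ ≤ M)
    {w : ℂ} {n k : ℕ} (hw : w ∈ regularSet G Z (n + k)) (h1 : M < ‖G^[n] w‖) :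
    M < ‖G^[n + k] w‖ := by
  induction k with
  | zero => exact h1
  | succ k ih =>
    have h2 := ih (regularSet_anti (by omega) hw)
    rw [← add_assoc, Function.iterate_succ_apply']
    exact h2.trans_le (hesc _ (hw (n + k) (by omega)) (hM.trans h2.le))

/-- If some iterates `G^[N j]` with `N j → ∞` converge to the identity on an open set `V` meeting
a ball that contains no critical value of an iterate, then all iterates are defined and uniformly
bounded near the centre of that ball. -/
theorem exists_ball_iterates_bounded (h : IsProperHolomorphic G Z) {ρ : ℝ}
    (hesc : ∀ w, w ∉ Z → ρ ≤ ‖w‖ → ‖w‖ ≤ ‖G w‖) {c : ℂ} {ε : ℝ} (hε : 0 < ε)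
    (hcrit : ∀ n, ∀ w ∈ regularSet G Z n, G^[n] w ∈ ball c ε → deriv G^[n] w ≠ 0)
    {V : Set ℂ} (hV : IsOpen V) (hne : (V ∩ ball c ε).Nonempty) {N : ℕ → ℕ}
    (hN : Tendsto N atTop atTop) (hreg : ∀ j, V ⊆ regularSet G Z (N j))
    (hlim : ∀ w ∈ V, Tendsto (fun y : ℕ × ℂ => G^[N y.1] y.2) (atTop ×ˢ 𝓝 w) (𝓝 w)) :
    ∃ δ > 0, ∃ M, ∀ n, ∀ w ∈ ball c δ, w ∈ regularSet G Z n ∧ ‖G^[n] w‖ ≤ M := by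
  obtain ⟨a, haV, haD⟩ := hne
  obtain ⟨j₀, η, hη, hηV, hmaps⟩ : ∃ j₀ : ℕ, ∃ η > 0, ball a η ⊆ V ∩ ball c ε ∧
      ∀ j ≥ j₀, MapsTo G^[N j] (ball a η) (ball c ε) := by
    have h1 := (hlim a haV).eventually (isOpen_ball.mem_nhds haD)
    obtain ⟨p, hp, q, hq, hpq⟩ := eventually_prod_iff.1 h1
    obtain ⟨j₀, hj₀⟩ := eventually_atTop.1 hp
    obtain ⟨η, hη, hb⟩ := Metric.mem_nhds_iff.1
      (inter_mem hq ((hV.inter isOpen_ball).mem_nhds ⟨haV, haD⟩))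
    exact ⟨j₀, η, hη, fun y hy => (hb hy).2, fun j hj y hy => hpq (hj₀ j hj) (hb hy).1⟩
  have haη := mem_ball_self (x := a) hη
  have hregη : ∀ j, ball a η ⊆ regularSet G Z (N j) := fun j y hy => hreg j (hηV hy).1
  have hbr : ∀ j, ∃ g : ℂ → ℂ, DifferentiableOn ℂ g (ball c ε) ∧
      g (G^[N (j + j₀)] a) = a ∧
      ∀ w ∈ ball c ε, g w ∈ regularSet G Z (N (j + j₀)) ∧ G^[N (j + j₀)] (g w) = w := fun j =>
    h.exists_inverse_branch hε (hcrit _) (hregη _ haη) (hmaps _ (by omega) haη)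
  choose g hgd hga hginv using hbr
  have hleft : ∀ j, LeftInvOn (g j) G^[N (j + j₀)] (ball a η) := fun j =>
    h.leftInvOn_ball (hgd j) (fun w hw => (hginv j w hw).2) hη (hregη _)
      (hmaps _ (by omega)) (hga j) (hcrit _ _ (hregη _ haη) (hmaps _ (by omega) haη))
  set M := max ρ (‖c‖ + ε) with hM
  have hDM : ∀ w ∈ ball c ε, ‖w‖ ≤ M := by
    intro w hw
    rw [mem_ball, dist_eq_norm] at hw
    have := norm_add_le (w - c) c
    rw [sub_add_cancel] at this
    exact le_max_of_le_right (by linarith)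
  have hbound : ∀ n k w, w ∈ regularSet G Z (n + k) → G^[n + k] w ∈ ball c ε →
      ‖G^[n] w‖ ≤ M := by
    intro n k w hw hw'
    by_contra! hlt
    exact absurd (lt_norm_iterate_add hesc (le_max_left _ _) hw hlt) (not_lt.2 (hDM _ hw'))
  have hgM : ∀ j, ∀ w ∈ ball c ε, ‖g j w‖ ≤ M := by
    intro j w hw
    have := hbound 0 (N (j + j₀)) (g j w)
    rw [zero_add] at this
    exact this (hginv j w hw).1 (by rwa [(hginv j w hw).2])
  obtain ⟨s, hs, g₀, hg₀c, hg₀⟩ := exists_subseq_tendsto_of_bounded hε hgd hgM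
  have hunif := tendstoLocallyUniformlyOn_of_tendsto_prod (F := fun j => g (s j)) isOpen_ball
    hg₀c hg₀
  have hNs : Tendsto (fun j => s j + j₀) atTop atTop :=
    tendsto_atTop_mono (fun j => Nat.le_add_right _ _) hs.tendsto_atTop
  have hid : EqOn g₀ id (ball c ε) := by
    have hd := hunif.differentiableOn (Eventually.of_forall fun j => hgd (s j)) isOpen_ball
    refine (hd.analyticOnNhd isOpen_ball).eqOn_of_preconnected_of_eventuallyEq (g := id)
      (fun z _ => analyticAt_id) (convex_ball c ε).isPreconnected haD ?_
    filter_upwards [isOpen_ball.mem_nhds haη] with y hy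
    have h1 : Tendsto (fun j => G^[N (s j + j₀)] y) atTop (𝓝 y) :=
      (hlim y (hηV hy).1).comp (hNs.prodMk (tendsto_const_nhds (x := y)))
    have h2 := (hg₀ y (hηV hy).2).comp (tendsto_id.prodMk h1)
    refine tendsto_nhds_unique h2 (tendsto_const_nhds.congr fun j => ?_)
    exact (hleft (s j) hy).symm
  have hclosed : closedBall c (ε / 2) ⊆ ball c ε := closedBall_subset_ball (by linarith)
  have hclose : ∀ᶠ j in atTop, ∀ z ∈ closedBall c (ε / 2), dist (g (s j) z) z < ε / 16 := by
    have h1 := (tendstoLocallyUniformlyOn_iff_forall_isCompact isOpen_ball).1 hunif _ hclosed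
      (isCompact_closedBall c (ε / 2))
    filter_upwards [Metric.tendstoUniformlyOn_iff.1 h1 (ε / 16) (by positivity)] with j hj z hz
    have := hj z hz
    rwa [hid (hclosed hz), dist_comm] at this
  have himage : ∀ᶠ j in atTop, ball c (ε / 16) ⊆ g (s j) '' closedBall c (ε / 2) := by
    filter_upwards [hclose] with j hj
    have hc : c ∈ closedBall c (ε / 2) := mem_closedBall_self (by positivity)
    have hdc : DiffContOnCl ℂ (g (s j)) (ball c (ε / 2)) := by
      apply DifferentiableOn.diffContOnCl
      rw [closure_ball c (by positivity)]
      exact (hgd (s j)).mono hclosed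
    have hsub := hdc.ball_subset_image_closedBall (ε := 3 * ε / 8) (by positivity)
      (fun z hz => ?_) ?_
    · refine Subset.trans (fun w hw => ?_) hsub
      rw [mem_ball] at hw ⊢
      have := dist_triangle w c (g (s j) c)
      have h2 := hj c hc
      rw [dist_comm] at h2
      linarith
    · rw [← dist_eq_norm]
      have h1 := hj z (sphere_subset_closedBall hz)
      have h2 := hj c hc
      rw [mem_sphere] at hz
      have h3 := dist_triangle4 z (g (s j) z) (g (s j) c) c
      rw [dist_comm] at h1
      linarith
    · have hne : ∃ᶠ z in 𝓝 c, z ∈ ({c} : Set ℂ)ᶜ :=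
        mem_closure_iff_frequently.1 (dense_compl_singleton c c)
      refine (hne.and_eventually (isOpen_ball.mem_nhds (mem_ball_self hε))).mono ?_
      rintro z ⟨hz1, hz2⟩ heq
      apply hz1
      have h1 := (hginv (s j) z hz2).2
      rw [heq, (hginv (s j) c (mem_ball_self hε)).2] at h1
      exact h1.symm
  refine ⟨ε / 16, by positivity, M, fun n w hw => ?_⟩
  obtain ⟨j, hj, hnj⟩ := (himage.and ((hN.comp hNs).eventually_ge_atTop n)).exists
  obtain ⟨v, hv, rfl⟩ := hj hw
  obtain ⟨hv1, hv2⟩ := hginv (s j) v (hclosed hv)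
  obtain ⟨k, hk⟩ := Nat.exists_eq_add_of_le hnj
  simp only [Function.comp_apply] at hk
  refine ⟨regularSet_anti hnj hv1, hbound n k _ (hk ▸ hv1) ?_⟩
  rw [← hk, hv2]
  exact hclosed hv

end IsProperHolomorphic
end HalleyDynamics

namespace HalleyDynamics

/-- The denominator of Halley's map in the coordinate `w = 1 / (z - r)`. -/
def conjDenom (r : ℝ) (w : ℂ) : ℂ := 1 + 3 * r * w + (2 * r ^ 2 - 2) * w ^ 2

/-- The cofactor of `w` in the numerator of Halley's map in the coordinate `w = 1 / (z - r)`. -/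
def conjNum (r : ℝ) (w : ℂ) : ℂ :=
  2 + 8 * r * w + (12 * r ^ 2 + 6) * w ^ 2 + 9 * r * (r ^ 2 + 2) * w ^ 3 +
    3 * (r ^ 2 + 2) ^ 2 * w ^ 4

/-- Halley's map for the cubic with real root `r`, in the coordinate `w = 1 / (z - r)`. -/
noncomputable def conjHalley (r : ℝ) (w : ℂ) : ℂ := w * conjNum r w / conjDenom r w

/-- The quadratic whose zeros are the two nonreal roots of the cubic, in the coordinate
`w = 1 / (z - r)`. -/
def conjQuad (r : ℝ) (w : ℂ) : ℂ := 1 + 3 * r * w + 3 * (r ^ 2 + 2) * w ^ 2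

/-- The poles of `conjHalley r`. -/
def conjPoles (r : ℝ) : Set ℂ := {w | conjDenom r w = 0}

variable {r : ℝ} {w : ℂ}

theorem ofReal_sq_add_ne_zero (r : ℝ) {a : ℝ} (ha : 0 < a) : (r : ℂ) ^ 2 + a ≠ 0 := by
  have : (r : ℂ) ^ 2 + a = ((r ^ 2 + a : ℝ) : ℂ) := by push_cast; ring
  rw [this, Complex.ofReal_ne_zero]
  positivity

theorem ne_zero_of_conjDenom_eq_zero (h : conjDenom r w = 0) : w ≠ 0 := by
  rintro rfl
  simp [conjDenom] at h

theorem conjDenom_ne_zero_of_conjQuad_eq_zero (h : conjQuad r w = 0) : conjDenom r w ≠ 0 := by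
  intro h'
  have h1 : ((r : ℂ) ^ 2 + (8 : ℝ)) * w ^ 2 = 0 := by
    simp only [conjQuad, conjDenom] at h h'
    push_cast
    linear_combination h - h'
  rcases mul_eq_zero.1 h1 with h2 | h2
  · exact ofReal_sq_add_ne_zero r (by norm_num) h2
  · exact ne_zero_of_conjDenom_eq_zero h' (pow_eq_zero_iff two_ne_zero |>.1 h2)

theorem conjNum_sub_conjDenom :
    conjNum r w - conjDenom r w = conjQuad r w * (1 + 2 * r * w + (r ^ 2 + 2) * w ^ 2) := by
  simp only [conjNum, conjDenom, conjQuad]; ring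

theorem mul_conjNum_ne_zero (h : conjDenom r w = 0) : w * conjNum r w ≠ 0 := by
  have hw := ne_zero_of_conjDenom_eq_zero h
  refine mul_ne_zero hw fun h0 => ?_
  have h1 := conjNum_sub_conjDenom (r := r) (w := w)
  rw [h, h0, sub_zero] at h1
  rcases mul_eq_zero.1 h1.symm with h2 | h2
  · exact conjDenom_ne_zero_of_conjQuad_eq_zero h2 h
  · have h3 : ((r : ℂ) ^ 2 + (8 : ℝ)) * w ^ 2 = 0 := by
      have h4 : r * (1 + r * w) * w = 4 * w * w := by
        simp only [conjDenom] at h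
        linear_combination h - h2
      have h5 : (r : ℂ) * (1 + r * w) = 4 * w := mul_right_cancel₀ hw h4
      push_cast
      linear_combination (1 / 2 : ℂ) * r ^ 2 * h2 - (1 / 2 : ℂ) * (r * (1 + r * w) + 4 * w) * h5
    rcases mul_eq_zero.1 h3 with h4 | h4
    · exact ofReal_sq_add_ne_zero r (by norm_num) h4
    · exact hw (pow_eq_zero_iff two_ne_zero |>.1 h4)

theorem hasDerivAt_conjHalley (h : conjDenom r w ≠ 0) :
    HasDerivAt (conjHalley r)
      (2 * conjQuad r w ^ 2 * ((1 + r * w) ^ 2 - w ^ 2) / conjDenom r w ^ 2) w := by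
  have hN : HasDerivAt (fun w => w * conjNum r w) (2 + 16 * r * w + 3 * (12 * r ^ 2 + 6) * w ^ 2 +
      4 * (9 * r * (r ^ 2 + 2)) * w ^ 3 + 5 * (3 * (r ^ 2 + 2) ^ 2) * w ^ 4) w := by
    have h0 := hasDerivAt_id w
    have := ((((((h0.const_mul (2 : ℂ))).add ((h0.pow 2).const_mul (8 * r : ℂ))).add
      ((h0.pow 3).const_mul (12 * r ^ 2 + 6 : ℂ))).add
      ((h0.pow 4).const_mul (9 * r * (r ^ 2 + 2) : ℂ))).add
      ((h0.pow 5).const_mul (3 * (r ^ 2 + 2) ^ 2 : ℂ)))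
    refine (this.congr_deriv ?_).congr_of_eventuallyEq (Eventually.of_forall fun y => ?_)
    · simp only [id]; norm_num; ring
    · simp only [conjNum, Pi.add_apply, Pi.pow_apply, id]; ring
  have hD : HasDerivAt (conjDenom r) (3 * r + 2 * (2 * r ^ 2 - 2) * w) w := by
    have h0 := hasDerivAt_id w
    have := (((h0.const_mul (3 * r : ℂ))).add ((h0.pow 2).const_mul (2 * r ^ 2 - 2 : ℂ))).const_add
      (1 : ℂ)
    refine (this.congr_deriv ?_).congr_of_eventuallyEq (Eventually.of_forall fun y => ?_)
    · simp only [id]; norm_num; ring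
    · simp only [conjDenom, Pi.add_apply, Pi.pow_apply, id]; ring
  refine (hN.div hD h).congr_deriv ?_
  congr 1
  simp only [conjNum, conjDenom, conjQuad]
  ring

theorem continuous_conjDenom (r : ℝ) : Continuous (conjDenom r) := by
  unfold conjDenom; fun_prop

theorem continuous_conjNum (r : ℝ) : Continuous (conjNum r) := by
  unfold conjNum; fun_prop

/-- The point at infinity is attracting for `conjHalley r`. -/
theorem exists_norm_le_norm_conjHalley (r : ℝ) :
    ∃ ρ : ℝ, ∀ w, w ∉ conjPoles r → ρ ≤ ‖w‖ → ‖w‖ ≤ ‖conjHalley r w‖ := by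
  have hc1 : Continuous fun u : ℂ => ‖u ^ 2 * (u ^ 2 + 3 * r * u + (2 * r ^ 2 - 2))‖ := by fun_prop
  have hc2 : Continuous fun u : ℂ => ‖2 * u ^ 4 + 8 * r * u ^ 3 + (12 * r ^ 2 + 6) * u ^ 2 +
      9 * r * (r ^ 2 + 2) * u + 3 * (r ^ 2 + 2) ^ 2‖ := by fun_prop
  have hev := hc1.continuousAt.eventually_lt (x₀ := 0) hc2.continuousAt (by
    have := pow_pos (norm_pos_iff.2 (ofReal_sq_add_ne_zero r (a := 2) (by norm_num))) 2
    simpa using this)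
  obtain ⟨δ, hδ, hball⟩ := Metric.eventually_nhds_iff.1 hev
  refine ⟨2 / δ, fun w hw hρ => ?_⟩
  have hwpos : 0 < ‖w‖ := lt_of_lt_of_le (by positivity) hρ
  have hw0 : w ≠ 0 := norm_pos_iff.1 hwpos
  have hlt := hball (y := w⁻¹) (by
    rw [dist_zero_right, norm_inv]
    rw [div_le_iff₀ hδ] at hρ
    rw [inv_lt_iff_one_lt_mul₀ hwpos]
    linarith)
  have hd : w⁻¹ ^ 2 * (w⁻¹ ^ 2 + 3 * r * w⁻¹ + (2 * r ^ 2 - 2)) = conjDenom r w * w⁻¹ ^ 4 := by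
    simp only [conjDenom]; field_simp
  have hn : 2 * w⁻¹ ^ 4 + 8 * r * w⁻¹ ^ 3 + (12 * r ^ 2 + 6) * w⁻¹ ^ 2 +
      9 * r * (r ^ 2 + 2) * w⁻¹ + 3 * (r ^ 2 + 2) ^ 2 = conjNum r w * w⁻¹ ^ 4 := by
    simp only [conjNum]; field_simp
  rw [hd, hn, norm_mul, norm_mul] at hlt
  have hlt' : ‖conjDenom r w‖ ≤ ‖conjNum r w‖ := (lt_of_mul_lt_mul_right hlt (norm_nonneg _)).le
  rw [conjHalley, norm_div, norm_mul, le_div_iff₀ (norm_pos_iff.2 hw)]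
  exact mul_le_mul_of_nonneg_left hlt' hwpos.le

theorem isProperHolomorphic_conjHalley (r : ℝ) :
    IsProperHolomorphic (conjHalley r) (conjPoles r) where
  isClosed := isClosed_eq (continuous_conjDenom r) continuous_const
  differentiableOn w hw := (hasDerivAt_conjHalley hw).differentiableAt.differentiableWithinAt
  isCompact_preimage K hK := by
    obtain ⟨ρ, hρ⟩ := exists_norm_le_norm_conjHalley r
    obtain ⟨C, hC⟩ := hK.isBounded.exists_norm_le
    refine Metric.isCompact_of_isClosed_isBounded (IsSeqClosed.isClosed ?_) ?_
    · intro u w hu huw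
      obtain ⟨y, hy, s, hs, hlim⟩ := hK.tendsto_subseq fun n => (hu n).2
      have hus := huw.comp hs.tendsto_atTop
      have h1 : Tendsto (fun n => u (s n) * conjNum r (u (s n))) atTop (𝓝 (w * conjNum r w)) :=
        hus.mul (((continuous_conjNum r).tendsto w).comp hus)
      have h2 : Tendsto (fun n => u (s n) * conjNum r (u (s n))) atTop
          (𝓝 (y * conjDenom r w)) := by
        refine (hlim.mul (((continuous_conjDenom r).tendsto w).comp hus)).congr fun n => ?_
        exact div_mul_cancel₀ _ (hu (s n)).1
      have h3 := tendsto_nhds_unique h1 h2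
      have hw : conjDenom r w ≠ 0 := fun h0 => by
        rw [h0, mul_zero] at h3
        exact mul_conjNum_ne_zero h0 h3
      refine ⟨hw, ?_⟩
      rw [mem_preimage, conjHalley, h3, mul_div_cancel_right₀ _ hw]
      exact hy
    · refine (Metric.isBounded_closedBall (x := (0 : ℂ)) (r := max ρ C)).subset fun w hw => ?_
      rw [mem_closedBall_zero_iff]
      by_contra! hlt
      obtain ⟨h1, h2⟩ := max_lt_iff.1 hlt
      exact absurd (hC _ hw.2) (not_le.2 (h2.trans_le (hρ w hw.1 h1.le)))

theorem im_conjHalley_eq_zero (h : w.im = 0) : (conjHalley r w).im = 0 := by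
  have hw : w = (w.re : ℂ) := Complex.ext rfl (by simpa using h)
  rw [hw]
  have : conjHalley r (w.re : ℂ) = ((w.re * (2 + 8 * r * w.re + (12 * r ^ 2 + 6) * w.re ^ 2 +
      9 * r * (r ^ 2 + 2) * w.re ^ 3 + 3 * (r ^ 2 + 2) ^ 2 * w.re ^ 4) /
        (1 + 3 * r * w.re + (2 * r ^ 2 - 2) * w.re ^ 2) : ℝ) : ℂ) := by
    simp only [conjHalley, conjNum, conjDenom]
    push_cast
    ring
  rw [this, Complex.ofReal_im]

theorem im_iterate_conjHalley_eq_zero (h : w.im = 0) (n : ℕ) : ((conjHalley r)^[n] w).im = 0 := by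
  induction n with
  | zero => exact h
  | succ n ih => rw [Function.iterate_succ_apply']; exact im_conjHalley_eq_zero ih

theorem conjHalley_eq_self (h : conjQuad r w = 0) : conjHalley r w = w := by
  have h1 := conjNum_sub_conjDenom (r := r) (w := w)
  rw [h, zero_mul, sub_eq_zero] at h1
  rw [conjHalley, h1, mul_div_cancel_right₀ _ (conjDenom_ne_zero_of_conjQuad_eq_zero h)]

theorem im_eq_zero_of_sq_eq_sq (h : (1 + r * w) ^ 2 - w ^ 2 = 0) : w.im = 0 := by
  have h1 : (1 + (r - 1) * w) * (1 + (r + 1) * w) = 0 := by linear_combination h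
  have key : ∀ t : ℝ, 1 + (t : ℂ) * w = 0 → w.im = 0 := by
    intro t ht
    have him := congrArg Complex.im ht
    have hre := congrArg Complex.re ht
    simp at him hre
    rcases him with h0 | h0
    · simp [h0] at hre
    · exact h0
  rcases mul_eq_zero.1 h1 with h2 | h2
  · exact key (r - 1) (by push_cast; exact h2)
  · exact key (r + 1) (by push_cast; exact h2)

/-- The critical values of the iterates of `conjHalley r` are real or zeros of `conjQuad r`. -/
theorem deriv_iterate_conjHalley_ne_zero {n : ℕ}
    (hw : w ∈ regularSet (conjHalley r) (conjPoles r) n)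
    (him : ((conjHalley r)^[n] w).im ≠ 0) (hq : conjQuad r ((conjHalley r)^[n] w) ≠ 0) :
    deriv (conjHalley r)^[n] w ≠ 0 := by
  induction n generalizing w with
  | zero => simp
  | succ n ih =>
    obtain ⟨h1, h2⟩ := mem_regularSet_succ.1 hw
    have hd := hasDerivAt_conjHalley h1
    have hd' : HasDerivAt (conjHalley r)^[n] _ (conjHalley r w) :=
      ((isProperHolomorphic_conjHalley r).hasStrictDerivAt_iterate h2).hasDerivAt
    rw [Function.iterate_succ, (hd'.comp w hd).deriv]
    refine mul_ne_zero (ih h2 him hq) (div_ne_zero (mul_ne_zero (mul_ne_zero two_ne_zero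
      (pow_ne_zero 2 fun h0 => ?_)) fun h0 => ?_) (pow_ne_zero 2 h1))
    · rw [Function.iterate_fixed (conjHalley_eq_self h0)] at hq
      exact hq h0
    · exact him (im_iterate_conjHalley_eq_zero (im_eq_zero_of_sq_eq_sq h0) _)

/-- The zeros of `conjQuad r` are attracting fixed points. -/
theorem exists_ball_tendsto_iterate {α : ℂ} (h : conjQuad r α = 0) :
    ∃ η > 0, ∀ w ∈ ball α η, Tendsto (fun n => (conjHalley r)^[n] w) atTop (𝓝 α) := by
  have hd := hasDerivAt_conjHalley (conjDenom_ne_zero_of_conjQuad_eq_zero h)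
  rw [h, zero_pow two_ne_zero, mul_zero, zero_mul, zero_div, hasDerivAt_iff_isLittleO] at hd
  obtain ⟨η, hη, hb⟩ := Metric.eventually_nhds_iff.1 (hd.def (c := 1 / 2) (by norm_num))
  simp only [smul_zero, sub_zero, conjHalley_eq_self h] at hb
  refine ⟨η, hη, fun w hw => ?_⟩
  have hind : ∀ n, ‖(conjHalley r)^[n] w - α‖ ≤ (1 / 2) ^ n * ‖w - α‖ := by
    intro n
    induction n with
    | zero => simp
    | succ n ih =>
      rw [Function.iterate_succ_apply']
      refine (hb (y := (conjHalley r)^[n] w) ?_).trans ?_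
      · rw [mem_ball, dist_eq_norm] at hw
        rw [dist_eq_norm]
        refine (ih.trans ?_).trans_lt hw
        exact mul_le_of_le_one_left (norm_nonneg _) (pow_le_one₀ (by norm_num) (by norm_num))
      · rw [pow_succ']; nlinarith
  rw [tendsto_iff_norm_sub_tendsto_zero]
  refine squeeze_zero (fun n => norm_nonneg _) hind ?_
  simpa using (tendsto_pow_atTop_nhds_zero_of_lt_one (r := (1 / 2 : ℝ)) (by norm_num)
    (by norm_num)).mul_const ‖w - α‖

/-- Each of the half planes above and below the real axis contains exactly one zero of
`conjQuad r`. -/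
theorem exists_unique_conjQuad_eq_zero (r : ℝ) {σ : ℝ} (hσ : σ ^ 2 = 1) :
    ∃ α : ℂ, 0 < σ * α.im ∧ conjQuad r α = 0 ∧
      ∀ w : ℂ, 0 < σ * w.im → conjQuad r w = 0 → w = α := by
  set s := Real.sqrt (3 * r ^ 2 + 24) with hs
  have hs2 : s ^ 2 = 3 * r ^ 2 + 24 := Real.sq_sqrt (by positivity)
  have hspos : 0 < s := Real.sqrt_pos.2 (by positivity)
  set α : ℂ := ⟨-3 * r / (6 * (r ^ 2 + 2)), σ * s / (6 * (r ^ 2 + 2))⟩ with hα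
  have hr : r ^ 2 + 2 ≠ 0 := by positivity
  have hpos : 0 < σ * α.im := by
    have : σ * α.im = s / (6 * (r ^ 2 + 2)) := by
      simp only [hα]; rw [← mul_div_assoc, ← mul_assoc, ← sq, hσ, one_mul]
    rw [this]; positivity
  have hroot : conjQuad r α = 0 := by
    apply Complex.ext
    · simp [conjQuad, hα, pow_two]
      field_simp
      nlinarith
    · simp [conjQuad, hα, pow_two]
      field_simp
      ring
  refine ⟨α, hpos, hroot, fun w hw hq => ?_⟩
  have hprod : (w - α) * (3 * r + 3 * (r ^ 2 + 2) * (w + α)) = 0 := by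
    simp only [conjQuad] at hq hroot
    linear_combination hq - hroot
  rcases mul_eq_zero.1 hprod with h1 | h1
  · exact sub_eq_zero.1 h1
  · exfalso
    have him := congrArg Complex.im h1
    simp [pow_two] at him
    have h2 : w.im + α.im = 0 := by
      rcases him with h3 | h3
      · nlinarith [sq_nonneg r]
      · exact h3
    have : σ * w.im + σ * α.im = 0 := by rw [← mul_add, h2, mul_zero]
    linarith

/-- An open half plane bounded by the real axis remains connected after removing a point. -/
theorem isPreconnected_halfPlane_diff_singleton {σ : ℝ} (hσ : σ ^ 2 = 1) (α : ℂ) :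
    IsPreconnected ({w : ℂ | 0 < σ * w.im} \ {α}) := by
  set E : ℂ → ℂ := fun z => z.re + σ * Real.exp z.im * Complex.I with hE
  have hEc : Continuous E := by fun_prop
  have hre : ∀ z, (E z).re = z.re := fun z => by simp [hE]
  have him : ∀ z, (E z).im = σ * Real.exp z.im := fun z => by simp [hE, -Complex.ofReal_exp]
  have hσ0 : σ ≠ 0 := by rintro rfl; norm_num at hσ
  have hinj : Function.Injective E := by
    intro z₁ z₂ h
    have h1 := congrArg Complex.re h
    have h2 := congrArg Complex.im h
    rw [hre, hre] at h1
    rw [him, him] at h2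
    exact Complex.ext h1 (Real.exp_injective (mul_left_cancel₀ hσ0 h2))
  have himage : {w : ℂ | 0 < σ * w.im} \ {α} = E '' (E ⁻¹' {α})ᶜ := by
    ext w
    constructor
    · rintro ⟨hw, hwα⟩
      have hEw : E ⟨w.re, Real.log (σ * w.im)⟩ = w := by
        apply Complex.ext
        · rw [hre]
        · rw [him, Real.exp_log hw, ← mul_assoc, ← sq, hσ, one_mul]
      exact ⟨_, by simpa [hEw] using hwα, hEw⟩
    · rintro ⟨z, hz, rfl⟩
      refine ⟨?_, hz⟩
      rw [mem_ofPred_eq, him, ← mul_assoc, ← sq, hσ, one_mul]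
      exact Real.exp_pos _
  rw [himage]
  refine IsPreconnected.image ?_ _ hEc.continuousOn
  refine (Set.Countable.isConnected_compl_of_one_lt_rank ?_ ?_).isPreconnected
  · rw [Complex.rank_real_complex]; norm_num
  · exact (countable_singleton α).preimage_of_injOn hinj.injOn

end HalleyDynamics

namespace HalleyDynamics

section RationalMaps

variable {P Q : ℂ[X]}

theorem num_mul_eq_mul_denom (hQ : Q ≠ 0) :
    (algebraMap ℂ[X] (RatFunc ℂ) P / algebraMap ℂ[X] (RatFunc ℂ) Q).num * Q =
      P * (algebraMap ℂ[X] (RatFunc ℂ) P / algebraMap ℂ[X] (RatFunc ℂ) Q).denom := by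
  set R := algebraMap ℂ[X] (RatFunc ℂ) P / algebraMap ℂ[X] (RatFunc ℂ) Q with hR
  have h1 := RatFunc.num_div_denom R
  have hd : algebraMap ℂ[X] (RatFunc ℂ) R.denom ≠ 0 :=
    RatFunc.algebraMap_ne_zero (RatFunc.denom_ne_zero R)
  have hQ' : algebraMap ℂ[X] (RatFunc ℂ) Q ≠ 0 := RatFunc.algebraMap_ne_zero hQ
  rw [hR, div_eq_div_iff hd hQ', ← map_mul, ← map_mul] at h1
  exact RatFunc.algebraMap_injective ℂ h1

/-- The self-map of the sphere given by a quotient without common zeros, at a finite point. -/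
theorem ratMap_div_coe (hQ : Q ≠ 0) (h : ∀ z, Q.eval z = 0 → P.eval z ≠ 0) (z : ℂ) :
    ratMap (algebraMap ℂ[X] (RatFunc ℂ) P / algebraMap ℂ[X] (RatFunc ℂ) Q) (OnePoint.some z) =
      if Q.eval z = 0 then OnePoint.infty else OnePoint.some (P.eval z / Q.eval z) := by
  have h1 := congrArg (Polynomial.eval z) (num_mul_eq_mul_denom (P := P) hQ)
  simp only [eval_mul] at h1
  set R := algebraMap ℂ[X] (RatFunc ℂ) P / algebraMap ℂ[X] (RatFunc ℂ) Q
  have hiff : R.denom.eval z = 0 ↔ Q.eval z = 0 := by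
    constructor
    · intro h0
      rw [h0, mul_zero] at h1
      refine (mul_eq_zero.1 h1).resolve_left fun h2 => ?_
      obtain ⟨u, v, huv⟩ := RatFunc.isCoprime_num_denom R
      have := congrArg (Polynomial.eval z) huv
      simp [h0, h2] at this
    · intro h0
      rw [h0, mul_zero] at h1
      exact (mul_eq_zero.1 h1.symm).resolve_left (h z h0)
  by_cases h0 : Q.eval z = 0
  · simp only [ratMap, if_pos h0, if_pos (hiff.2 h0)]
  · have h0' : R.denom.eval z ≠ 0 := fun h2 => h0 (hiff.1 h2)
    simp only [ratMap, if_neg h0, if_neg h0']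
    rw [(div_eq_div_iff h0' h0).2 h1]

theorem ratMap_div_infty (hdeg : Q.natDegree < P.natDegree) (hQ : Q ≠ 0) :
    ratMap (algebraMap ℂ[X] (RatFunc ℂ) P / algebraMap ℂ[X] (RatFunc ℂ) Q) OnePoint.infty =
      OnePoint.infty := by
  have h1 := congrArg natDegree (num_mul_eq_mul_denom (P := P) hQ)
  set R := algebraMap ℂ[X] (RatFunc ℂ) P / algebraMap ℂ[X] (RatFunc ℂ) Q
  have hP : P ≠ 0 := by rintro rfl; simp at hdeg
  have hd : R.denom ≠ 0 := RatFunc.denom_ne_zero R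
  have hn : R.num ≠ 0 := by
    intro h0
    have h2 := num_mul_eq_mul_denom (P := P) hQ
    rw [show (algebraMap ℂ[X] (RatFunc ℂ) P / algebraMap ℂ[X] (RatFunc ℂ) Q).num = 0 from h0,
      zero_mul] at h2
    exact mul_ne_zero hP hd h2.symm
  rw [natDegree_mul hn hQ, natDegree_mul hP hd] at h1
  have hc : R.denom.coeff (max R.num.natDegree R.denom.natDegree) = 0 :=
    coeff_eq_zero_of_natDegree_lt (lt_max_of_lt_left (by omega))
  simp only [ratMap, hc, if_true]

end RationalMaps

section HalleyFormula

/-- The numerator of Halley's map for `z³ + 6 z + b`. -/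
noncomputable def halleyNum (b : ℂ) : ℂ[X] := X ^ 5 - 2 * X ^ 3 - 2 * C b * X ^ 2 - 2 * C b

/-- The denominator of Halley's map for `z³ + 6 z + b`. -/
noncomputable def halleyDenom (b : ℂ) : ℂ[X] := 2 * X ^ 4 + 6 * X ^ 2 - C b * X + 12

theorem natDegree_halleyNum (b : ℂ) : (halleyNum b).natDegree = 5 := by
  have : halleyNum b = X ^ 5 - C 2 * X ^ 3 - C (2 * b) * X ^ 2 - C (2 * b) := by
    simp only [halleyNum, map_mul, map_ofNat]
  rw [this]
  compute_degree!

theorem natDegree_halleyDenom (b : ℂ) : (halleyDenom b).natDegree = 4 := by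
  have : halleyDenom b = C 2 * X ^ 4 + C 6 * X ^ 2 - C b * X + C 12 := by
    simp only [halleyDenom, map_ofNat]
  rw [this]
  compute_degree!

theorem halleyDenom_ne_zero (b : ℂ) : halleyDenom b ≠ 0 := fun h => by
  simpa [h] using natDegree_halleyDenom b

theorem halley_cubic_eq (b : ℂ) :
    halley (cubic b) = algebraMap ℂ[X] (RatFunc ℂ) (halleyNum b) /
      algebraMap ℂ[X] (RatFunc ℂ) (halleyDenom b) := by
  have h1 : derivative (cubic b) = 3 * X ^ 2 + 6 := by
    have : cubic b = X ^ 3 + C 6 * X + C b := by simp only [cubic, map_ofNat]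
    rw [this]
    simp only [derivative_add, derivative_C_mul, derivative_X_pow, derivative_X, derivative_C]
    simp only [map_ofNat, Nat.cast_ofNat, Nat.add_one_sub_one, mul_one, add_zero]
  have h2 : derivative (derivative (cubic b)) = 6 * X := by
    have : (3 * X ^ 2 + 6 : ℂ[X]) = C 3 * X ^ 2 + C 6 := by simp only [map_ofNat]
    rw [h1, this]
    simp only [derivative_add, derivative_C_mul, derivative_X_pow, derivative_C]
    simp only [map_ofNat, Nat.cast_ofNat, Nat.add_one_sub_one, pow_one, add_zero]
    ring
  have h6 : (6 : ℂ[X]) ≠ 0 := by norm_num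
  have hB : 2 * derivative (cubic b) ^ 2 - cubic b * derivative (derivative (cubic b)) =
      6 * halleyDenom b := by
    rw [h2, h1]; simp only [cubic, halleyDenom]; ring
  have hB0 := RatFunc.algebraMap_ne_zero (mul_ne_zero h6 (halleyDenom_ne_zero b))
  rw [halley, hB, ← RatFunc.algebraMap_X, sub_div' hB0, div_eq_div_iff hB0
    (RatFunc.algebraMap_ne_zero (halleyDenom_ne_zero b)), ← map_mul, ← map_sub, ← map_mul,
    ← map_mul, h1]
  congr 1
  simp only [cubic, halleyDenom, halleyNum]
  ring

variable {r : ℝ}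

theorem eval_halleyDenom {w : ℂ} (hw : w ≠ 0) :
    (halleyDenom (-(r ^ 3 + 6 * r))).eval (r + w⁻¹) = conjNum r w / w ^ 4 := by
  simp only [halleyDenom, conjNum, eval_add, eval_sub, eval_mul, eval_pow, eval_X, eval_C,
    eval_ofNat]
  field_simp
  ring

theorem eval_halleyNum {w : ℂ} (hw : w ≠ 0) :
    (halleyNum (-(r ^ 3 + 6 * r))).eval (r + w⁻¹) =
      r * (conjNum r w / w ^ 4) + conjDenom r w / w ^ 5 := by
  simp only [halleyNum, conjNum, conjDenom, eval_sub, eval_mul, eval_pow, eval_X, eval_C,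
    eval_ofNat]
  field_simp
  ring

theorem eval_halleyDenom_self :
    (halleyDenom (-(r ^ 3 + 6 * r))).eval (r : ℂ) = 3 * ((r : ℂ) ^ 2 + (2 : ℝ)) ^ 2 := by
  simp only [halleyDenom, eval_add, eval_sub, eval_mul, eval_pow, eval_X, eval_C, eval_ofNat]
  push_cast
  ring

theorem eval_halleyDenom_self_ne_zero : (halleyDenom (-(r ^ 3 + 6 * r))).eval (r : ℂ) ≠ 0 := by
  rw [eval_halleyDenom_self]
  exact mul_ne_zero three_ne_zero (pow_ne_zero 2 (ofReal_sq_add_ne_zero r (by norm_num)))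

theorem eval_halleyNum_self : (halleyNum (-(r ^ 3 + 6 * r))).eval (r : ℂ) =
    r * (halleyDenom (-(r ^ 3 + 6 * r))).eval (r : ℂ) := by
  simp only [halleyDenom, halleyNum, eval_add, eval_sub, eval_mul, eval_pow, eval_X, eval_C,
    eval_ofNat]
  ring

theorem eval_halleyNum_ne_zero (z : ℂ) (hz : (halleyDenom (-(r ^ 3 + 6 * r))).eval z = 0) :
    (halleyNum (-(r ^ 3 + 6 * r))).eval z ≠ 0 := by
  have hzr : z - r ≠ 0 := by
    intro h0
    rw [sub_eq_zero.1 h0] at hz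
    exact eval_halleyDenom_self_ne_zero hz
  have hw : (z - r)⁻¹ ≠ 0 := inv_ne_zero hzr
  have hzw : z = r + ((z - r)⁻¹)⁻¹ := by rw [inv_inv]; ring
  set w := (z - r)⁻¹
  rw [hzw] at hz ⊢
  rw [eval_halleyDenom hw] at hz
  rw [eval_halleyNum hw, hz, mul_zero, zero_add]
  refine div_ne_zero (fun h0 => mul_conjNum_ne_zero h0 ?_) (pow_ne_zero _ hw)
  rw [(div_eq_zero_iff.1 hz).resolve_right (pow_ne_zero _ hw), mul_zero]

/-- Halley's map for the cubic with real root `r`. -/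
noncomputable def halleyMap (r : ℝ) : Sphere → Sphere :=
  ratMap (halley (cubic (-(r ^ 3 + 6 * r))))

theorem halleyMap_coe (z : ℂ) : halleyMap r (OnePoint.some z) =
    if (halleyDenom (-(r ^ 3 + 6 * r))).eval z = 0 then OnePoint.infty else
      OnePoint.some ((halleyNum (-(r ^ 3 + 6 * r))).eval z /
        (halleyDenom (-(r ^ 3 + 6 * r))).eval z) := by
  rw [halleyMap, halley_cubic_eq]
  exact ratMap_div_coe (halleyDenom_ne_zero _) eval_halleyNum_ne_zero z

theorem halleyMap_infty : halleyMap r OnePoint.infty = OnePoint.infty := by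
  rw [halleyMap, halley_cubic_eq]
  refine ratMap_div_infty ?_ (halleyDenom_ne_zero _)
  rw [natDegree_halleyDenom, natDegree_halleyNum]
  norm_num

theorem halleyMap_root : halleyMap r (OnePoint.some (r : ℂ)) = OnePoint.some (r : ℂ) := by
  rw [halleyMap_coe, if_neg eval_halleyDenom_self_ne_zero, eval_halleyNum_self,
    mul_div_cancel_right₀ _ eval_halleyDenom_self_ne_zero]

end HalleyFormula

section Chart

/-- The inverse of the chart `z ↦ 1 / (z - r)` on the complement of `r`. -/
noncomputable def rootChart (r : ℝ) (w : ℂ) : Sphere :=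
  open scoped Classical in if w = 0 then OnePoint.infty else OnePoint.some (r + w⁻¹)

variable {r : ℝ}

theorem rootChart_zero : rootChart r 0 = OnePoint.infty := by simp [rootChart]

theorem rootChart_of_ne_zero {w : ℂ} (hw : w ≠ 0) : rootChart r w = OnePoint.some (r + w⁻¹) := by
  simp [rootChart, hw]

theorem rootChart_ne_root (w : ℂ) : rootChart r w ≠ OnePoint.some (r : ℂ) := by
  by_cases hw : w = 0
  · rw [hw, rootChart_zero]; exact OnePoint.infty_ne_coe _
  · rw [rootChart_of_ne_zero hw, Ne, OnePoint.some_eq_iff]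
    simpa using hw

theorem rootChart_injective : Function.Injective (rootChart r) := by
  intro w₁ w₂ h
  by_cases h1 : w₁ = 0 <;> by_cases h2 : w₂ = 0
  · rw [h1, h2]
  · rw [h1, rootChart_zero, rootChart_of_ne_zero h2] at h
    exact absurd h (OnePoint.infty_ne_coe _)
  · rw [h2, rootChart_zero, rootChart_of_ne_zero h1] at h
    exact absurd h (OnePoint.coe_ne_infty _)
  · rw [rootChart_of_ne_zero h1, rootChart_of_ne_zero h2, OnePoint.some_eq_iff] at h
    simpa using h

theorem continuous_rootChart : Continuous (rootChart r) := by
  rw [continuous_iff_continuousAt]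
  intro w
  by_cases hw : w = 0
  · subst hw
    rw [continuousAt_iff_punctured_nhds, rootChart_zero]
    have h1 : Tendsto (fun w : ℂ => (r : ℂ) + w⁻¹) (𝓝[≠] 0) (coclosedCompact ℂ) := by
      rw [coclosedCompact_eq_cocompact, ← Metric.cobounded_eq_cocompact]
      exact (tendsto_const_add_cobounded _).comp tendsto_inv₀_nhdsNE_zero
    refine (OnePoint.tendsto_coe_infty.comp h1).congr' ?_
    filter_upwards [self_mem_nhdsWithin] with w hw
    exact (rootChart_of_ne_zero hw).symm
  · have h1 : ContinuousAt (fun w : ℂ => OnePoint.some ((r : ℂ) + w⁻¹)) w :=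
      OnePoint.continuous_coe.continuousAt.comp
        (continuousAt_const.add (continuousAt_inv₀ hw))
    refine h1.congr ?_
    filter_upwards [isOpen_ne.mem_nhds hw] with y hy
    exact (rootChart_of_ne_zero hy).symm

/-- The Möbius transformation `w ↦ r + 1 / w` as a self-homeomorphism of the sphere. -/
theorem exists_homeomorph_rootChart (r : ℝ) :
    ∃ M : Sphere ≃ₜ Sphere, ∀ w : ℂ, M (OnePoint.some w) = rootChart r w := by
  set f : Sphere → Sphere := fun z => z.elim (OnePoint.some (r : ℂ)) (rootChart r) with hf
  have hcont : Continuous f := by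
    rw [OnePoint.continuous_iff]
    refine ⟨?_, continuous_rootChart⟩
    have h1 : Tendsto (fun w : ℂ => (r : ℂ) + w⁻¹) (coclosedCompact ℂ) (𝓝 r) := by
      rw [coclosedCompact_eq_cocompact, ← Metric.cobounded_eq_cocompact]
      simpa using (tendsto_const_nhds (x := (r : ℂ))).add tendsto_inv₀_cobounded
    refine ((OnePoint.continuous_coe.tendsto (r : ℂ)).comp h1).congr' ?_
    have h2 : ∀ᶠ w : ℂ in coclosedCompact ℂ, w ≠ 0 := by
      rw [coclosedCompact_eq_cocompact]
      exact (isCompact_singleton (x := (0 : ℂ))).compl_mem_cocompact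
    filter_upwards [h2] with w hw
    exact (rootChart_of_ne_zero hw).symm
  have hinj : Function.Injective f := by
    intro z₁ z₂ h
    induction z₁ using OnePoint.rec <;> induction z₂ using OnePoint.rec
    · rfl
    · exact absurd h.symm (rootChart_ne_root _)
    · exact absurd h (rootChart_ne_root _)
    · exact congrArg _ (rootChart_injective h)
  have hsurj : Function.Surjective f := by
    intro z
    induction z using OnePoint.rec with
    | infty => exact ⟨OnePoint.some 0, rootChart_zero⟩
    | coe z =>
      by_cases hz : z = r
      · exact ⟨OnePoint.infty, by rw [hz]; rfl⟩
      · refine ⟨OnePoint.some (z - r)⁻¹, ?_⟩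
        have : (z - r)⁻¹ ≠ 0 := inv_ne_zero (sub_ne_zero.2 hz)
        exact (rootChart_of_ne_zero this).trans (by rw [inv_inv, add_sub_cancel])
  exact ⟨hcont.homeoOfEquivCompactToT2 (f := Equiv.ofBijective f ⟨hinj, hsurj⟩), fun w => rfl⟩

theorem isOpenEmbedding_rootChart (r : ℝ) : Topology.IsOpenEmbedding (rootChart r) := by
  obtain ⟨M, hM⟩ := exists_homeomorph_rootChart r
  have : rootChart r = M ∘ OnePoint.some := funext fun w => (hM w).symm
  rw [this]
  exact M.isOpenEmbedding.comp OnePoint.isOpenEmbedding_coe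

theorem denseRange_rootChart (r : ℝ) : DenseRange (rootChart r) := by
  obtain ⟨M, hM⟩ := exists_homeomorph_rootChart r
  have : rootChart r = M ∘ OnePoint.some := funext fun w => (hM w).symm
  rw [this]
  exact M.surjective.denseRange.comp OnePoint.denseRange_coe M.continuous

/-- Halley's map in the chart `rootChart r`. -/
theorem halleyMap_rootChart (w : ℂ) : halleyMap r (rootChart r w) =
    open scoped Classical in
    if w ∈ conjPoles r then OnePoint.some (r : ℂ) else rootChart r (conjHalley r w) := by
  by_cases hw : w = 0
  · have h0 : (0 : ℂ) ∉ conjPoles r := by simp [conjPoles, conjDenom]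
    rw [hw, if_neg h0, rootChart_zero, halleyMap_infty]
    simp [conjHalley, rootChart_zero]
  rw [rootChart_of_ne_zero hw, halleyMap_coe, eval_halleyDenom hw, eval_halleyNum hw]
  have hw4 : w ^ 4 ≠ 0 := pow_ne_zero _ hw
  by_cases hd : conjDenom r w = 0
  · have hn : conjNum r w / w ^ 4 ≠ 0 :=
      div_ne_zero (right_ne_zero_of_mul (mul_conjNum_ne_zero hd)) hw4
    rw [if_neg hn, if_pos (show w ∈ conjPoles r from hd), hd, zero_div, add_zero,
      mul_div_cancel_right₀ _ hn]
  · rw [if_neg (show w ∉ conjPoles r from hd)]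
    by_cases hn : conjNum r w = 0
    · rw [hn, zero_div, if_pos rfl, conjHalley, hn, mul_zero, zero_div, rootChart_zero]
    · have hG : conjHalley r w ≠ 0 := div_ne_zero (mul_ne_zero hw hn) hd
      rw [if_neg (div_ne_zero hn hw4), rootChart_of_ne_zero hG, conjHalley]
      congr 1
      field_simp

theorem iterate_halleyMap_root (n : ℕ) :
    (halleyMap r)^[n] (OnePoint.some (r : ℂ)) = OnePoint.some (r : ℂ) :=
  Function.iterate_fixed halleyMap_root n

theorem iterate_halleyMap_rootChart {n : ℕ} {w : ℂ}
    (hw : w ∈ regularSet (conjHalley r) (conjPoles r) n) :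
    (halleyMap r)^[n] (rootChart r w) = rootChart r ((conjHalley r)^[n] w) := by
  induction n generalizing w with
  | zero => rfl
  | succ n ih =>
    obtain ⟨h1, h2⟩ := mem_regularSet_succ.1 hw
    rw [Function.iterate_succ_apply, Function.iterate_succ_apply, halleyMap_rootChart,
      if_neg h1, ih h2]

theorem iterate_halleyMap_rootChart_of_notMem {n : ℕ} {w : ℂ}
    (hw : w ∉ regularSet (conjHalley r) (conjPoles r) n) :
    (halleyMap r)^[n] (rootChart r w) = OnePoint.some (r : ℂ) := by
  induction n generalizing w with
  | zero => exact absurd (by simp [regularSet_zero]) hw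
  | succ n ih =>
    rw [Function.iterate_succ_apply, halleyMap_rootChart]
    by_cases h1 : w ∈ conjPoles r
    · rw [if_pos h1, iterate_halleyMap_root]
    · rw [if_neg h1]
      exact ih fun h2 => hw (mem_regularSet_succ.2 ⟨h1, h2⟩)

/-- A point near which all iterates of `conjHalley r` are defined and uniformly bounded belongs to
the Fatou set of Halley's map. -/
theorem rootChart_mem_fatouSet {c : ℂ} {δ M : ℝ} (hδ : 0 < δ)
    (h : ∀ n, ∀ w ∈ ball c δ, w ∈ regularSet (conjHalley r) (conjPoles r) n ∧
      ‖(conjHalley r)^[n] w‖ ≤ M) :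
    rootChart r c ∈ fatouSet (halleyMap r) := by
  have hemb := isOpenEmbedding_rootChart r
  refine ⟨rootChart r '' ball c δ, hemb.isOpenMap _ isOpen_ball,
    mem_image_of_mem _ (mem_ball_self hδ), ?_⟩
  intro f hf
  choose m hm using hf
  obtain ⟨s, hs, g, hgc, hg⟩ := exists_subseq_tendsto_of_bounded hδ
    (f := fun n => (conjHalley r)^[m n])
    (fun n => ((isProperHolomorphic_conjHalley r).differentiableOn_iterate (m n)).mono
      fun w hw => (h (m n) w hw).1) (fun n w hw => (h (m n) w hw).2)
  have hinv : ∀ w, Function.invFun (rootChart r) (rootChart r w) = w :=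
    Function.leftInverse_invFun hemb.injective
  refine ⟨s, hs, fun z => rootChart r (g (Function.invFun (rootChart r) z)), ?_⟩
  let : UniformSpace Sphere := uniformSpaceOfCompactR1
  refine tendstoLocallyUniformlyOn_of_tendsto_prod (hemb.isOpenMap _ isOpen_ball) ?_ ?_
  · rintro _ ⟨w, hw, rfl⟩
    refine ContinuousAt.continuousWithinAt ?_
    rw [← hemb.continuousAt_iff]
    have h1 : ContinuousAt (fun w => rootChart r (g w)) w :=
      continuous_rootChart.continuousAt.comp (hgc.continuousAt (isOpen_ball.mem_nhds hw))
    refine h1.congr (Eventually.of_forall fun y => ?_)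
    simp only [Function.comp_apply, hinv]
  · rintro _ ⟨w, hw, rfl⟩
    rw [← hemb.map_nhds_eq, prod_map_right, tendsto_map'_iff]
    simp only [hinv]
    refine ((continuous_rootChart.tendsto _).comp (hg w hw)).congr' ?_
    filter_upwards [tendsto_snd.eventually (isOpen_ball.mem_nhds hw)] with y hy
    have := iterate_halleyMap_rootChart (h (m (s y.1)) y.2 hy).1
    simp only [Function.comp_apply, ← hm, Prod.map_fst, Prod.map_snd, id, this]

end Chart

section Rotation

/-- On a domain conjugate to a rotation, a subsequence of the iterates converges to the identity. -/
theorem IsConjToIrrationalRotation.exists_tendsto_self {S : Sphere → Sphere} {U : Set Sphere}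
    {W : Set ℂ} (h : IsConjToIrrationalRotation S U W)
    (hW : ∀ z ∈ W, ∀ u : ℂ, ‖u‖ = 1 → u * z ∈ W) :
    IsOpen U ∧ ∃ N : ℕ → ℕ, StrictMono N ∧
      ∀ x ∈ U, Tendsto (fun y : ℕ × Sphere => S^[N y.1] y.2) (atTop ×ˢ 𝓝 x) (𝓝 x) := by
  obtain ⟨hmaps, φ, rfl, rfl, -, θ, -, hconj⟩ := h
  refine ⟨φ.open_source, ?_⟩
  set u : Circle := Circle.exp (2 * Real.pi * θ) with hu
  have hucoe : Complex.exp (2 * Real.pi * Complex.I * θ) = u := by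
    rw [hu, Circle.coe_exp]; push_cast; ring_nf
  rw [hucoe] at hconj
  have hstep : ∀ y ∈ φ.source, φ (S y) = u * φ y := fun y hy => by
    have := hconj (φ y) (φ.map_source hy)
    rwa [φ.left_inv hy] at this
  have hiter : ∀ n, ∀ y ∈ φ.source, S^[n] y = φ.symm (u ^ n * φ y) := by
    intro n y hy
    have hmem : ∀ n, S^[n] y ∈ φ.source := fun n => (hmaps.iterate n) hy
    have h1 : φ (S^[n] y) = u ^ n * φ y := by
      induction n with
      | zero => simp
      | succ n ih => rw [Function.iterate_succ_apply', hstep _ (hmem n), ih]; ring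
    rw [← h1, φ.left_inv (hmem n)]
  obtain ⟨N, hN, hlim⟩ := (mapClusterPt_one_atTop_pow u).tendsto_subseq
  refine ⟨N, hN, fun x hx => ?_⟩
  have h1 : Tendsto (fun j => (u : ℂ) ^ N j) atTop (𝓝 1) := by
    have hc : Continuous ((↑) : Circle → ℂ) := by fun_prop
    have h0 : Tendsto (fun j => ((u ^ N j : Circle) : ℂ)) atTop (𝓝 ((1 : Circle) : ℂ)) :=
      (hc.tendsto 1).comp hlim
    rw [Circle.coe_one] at h0
    exact h0.congr fun j => Circle.coe_pow u (N j)
  have h2 : Tendsto (fun y : ℕ × Sphere => (u : ℂ) ^ N y.1 * φ y.2) (atTop ×ˢ 𝓝 x)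
      (𝓝 (1 * φ x)) :=
    (h1.comp tendsto_fst).mul ((φ.continuousAt hx).tendsto.comp tendsto_snd)
  rw [one_mul] at h2
  have h3 := (φ.symm.continuousAt (x := φ x) (φ.map_source hx)).tendsto.comp h2
  rw [φ.left_inv hx] at h3
  refine h3.congr' ?_
  filter_upwards [tendsto_snd.eventually (φ.open_source.mem_nhds hx)] with y hy
  exact (hiter _ _ hy).symm

/-- On a rotation domain, iterates of arbitrarily high order converge to the identity. -/
theorem IsRotationDomain.exists_tendsto_self {R : Sphere → Sphere} {U : Set Sphere}
    (h : IsRotationDomain R U) :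
    IsOpen U ∧ ∃ N : ℕ → ℕ, Tendsto N atTop atTop ∧
      ∀ x ∈ U, Tendsto (fun y : ℕ × Sphere => R^[N y.1] y.2) (atTop ×ˢ 𝓝 x) (𝓝 x) := by
  have key : ∀ k, 1 ≤ k → ∀ W, IsConjToIrrationalRotation R^[k] U W →
      (∀ z ∈ W, ∀ u : ℂ, ‖u‖ = 1 → u * z ∈ W) → IsOpen U ∧ ∃ N : ℕ → ℕ, Tendsto N atTop atTop ∧
      ∀ x ∈ U, Tendsto (fun y : ℕ × Sphere => R^[N y.1] y.2) (atTop ×ˢ 𝓝 x) (𝓝 x) := by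
    intro k hk W hconj hW
    obtain ⟨hU, N, hN, hlim⟩ := hconj.exists_tendsto_self hW
    refine ⟨hU, fun j => k * N j, tendsto_atTop_mono (fun j => Nat.le_mul_of_pos_left _ hk)
      hN.tendsto_atTop, fun x hx => ?_⟩
    simpa only [Function.iterate_mul] using hlim x hx
  rcases h with ⟨-, k, hk, hconj⟩ | ⟨-, k, hk, ρ, -, hconj⟩
  · refine key k hk _ hconj fun z hz u hu => ?_
    rw [mem_ofPred_eq] at hz ⊢
    rwa [norm_mul, hu, one_mul]
  · refine key k hk _ hconj fun z hz u hu => ?_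
    rw [mem_ofPred_eq] at hz ⊢
    rwa [norm_mul, hu, one_mul]

theorem IsRotationDomain.isFatouComponent {R : Sphere → Sphere} {U : Set Sphere}
    (h : IsRotationDomain R U) : IsFatouComponent R U := by
  rcases h with h | h <;> exact h.1

/-- A Fatou component is closed relative to the Fatou set. -/
theorem IsFatouComponent.mem_of_mem_closure {R : Sphere → Sphere} {U : Set Sphere}
    (h : IsFatouComponent R U) {x : Sphere} (hx : x ∈ fatouSet R) (hxU : x ∈ closure U) :
    x ∈ U := by
  obtain ⟨z, hz, rfl⟩ := h
  have hpre : IsPreconnected (insert x (connectedComponentIn (fatouSet R) z)) :=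
    isPreconnected_connectedComponentIn.subset_closure (subset_insert _ _)
      (insert_subset hxU subset_closure)
  exact hpre.subset_connectedComponentIn (mem_insert_of_mem _ (mem_connectedComponentIn hz))
    (insert_subset hx (connectedComponentIn_subset _ _)) (mem_insert _ _)

theorem IsFatouComponent.nonempty {R : Sphere → Sphere} {U : Set Sphere}
    (h : IsFatouComponent R U) : U.Nonempty := by
  obtain ⟨z, hz, rfl⟩ := h
  exact ⟨z, mem_connectedComponentIn hz⟩

end Rotation

theorem exists_mem_im_ne_zero {V : Set ℂ} (hV : IsOpen V) (hne : V.Nonempty) :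
    ∃ w ∈ V, w.im ≠ 0 := by
  obtain ⟨w, hw⟩ := hne
  by_cases h : w.im = 0
  · obtain ⟨ε, hε, hb⟩ := Metric.isOpen_iff.1 hV w hw
    refine ⟨w + (ε / 2 : ℝ) * Complex.I, hb ?_, ?_⟩
    · rw [mem_ball, dist_eq_norm, add_sub_cancel_left, norm_mul, Complex.norm_I, mul_one,
        Complex.norm_real, Real.norm_eq_abs, abs_of_pos (by positivity)]
      linarith
    · simp [h, hε.ne']
  · exact ⟨w, hw, h⟩

/-- Halley's map for the cubic with real root `r` has no rotation domain. -/
theorem not_isRotationDomain_halleyMap (r : ℝ) (U : Set Sphere) :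
    ¬ IsRotationDomain (halleyMap r) U := by
  intro hrot
  obtain ⟨hU, N, hN, hlim⟩ := hrot.exists_tendsto_self
  have hemb := isOpenEmbedding_rootChart r
  set V : Set ℂ := rootChart r ⁻¹' U with hVdef
  have hV : IsOpen V := hU.preimage continuous_rootChart
  have hVne : V.Nonempty := by
    obtain ⟨_, hx, w, rfl⟩ := (denseRange_rootChart r).inter_open_nonempty U hU
      hrot.isFatouComponent.nonempty
    exact ⟨w, hx⟩
  have hreg : ∀ n, V ⊆ regularSet (conjHalley r) (conjPoles r) n := by
    intro n w hw
    by_contra hn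
    have h1 : Tendsto (fun j => (halleyMap r)^[N j] (rootChart r w)) atTop
        (𝓝 (rootChart r w)) :=
      (hlim _ hw).comp (tendsto_id.prodMk (tendsto_const_nhds (x := rootChart r w)))
    refine rootChart_ne_root w (tendsto_nhds_unique h1 (tendsto_const_nhds.congr' ?_))
    filter_upwards [hN.eventually_ge_atTop n] with j hj
    exact (iterate_halleyMap_rootChart_of_notMem fun h => hn (regularSet_anti hj h)).symm
  have hlimV : ∀ w ∈ V, Tendsto (fun y : ℕ × ℂ => (conjHalley r)^[N y.1] y.2)
      (atTop ×ˢ 𝓝 w) (𝓝 w) := by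
    intro w hw
    rw [hemb.tendsto_nhds_iff]
    have h1 := (hlim _ hw).comp (tendsto_fst.prodMk
      ((continuous_rootChart.tendsto w).comp (tendsto_snd (f := (atTop : Filter ℕ)))))
    refine h1.congr' ?_
    filter_upwards [tendsto_snd.eventually (hV.mem_nhds hw)] with y hy
    exact iterate_halleyMap_rootChart (hreg _ hy)
  obtain ⟨w₁, hw₁, him₁⟩ := exists_mem_im_ne_zero hV hVne
  obtain ⟨σ, hσ, hσ₁⟩ : ∃ σ : ℝ, σ ^ 2 = 1 ∧ 0 < σ * w₁.im := by
    rcases him₁.lt_or_gt with h | h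
    · exact ⟨-1, by norm_num, by linarith⟩
    · exact ⟨1, by norm_num, by linarith⟩
  obtain ⟨α, hα, hαq, hαu⟩ := exists_unique_conjQuad_eq_zero r hσ
  have hTo : IsOpen {w : ℂ | 0 < σ * w.im} :=
    isOpen_lt continuous_const (continuous_const.mul Complex.continuous_im)
  set A : Set ℂ := {w : ℂ | 0 < σ * w.im} \ {α} with hA
  have hAo : IsOpen A := hTo.sdiff isClosed_singleton
  have hAV : (A ∩ V).Nonempty := by
    obtain ⟨w, ⟨hw1, hw2⟩, hw3⟩ := (dense_compl_singleton α).inter_open_nonempty _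
      (hTo.inter hV) ⟨w₁, hσ₁, hw₁⟩
    exact ⟨w, ⟨hw1, hw3⟩, hw2⟩
  obtain ⟨w₀, hw₀c, hw₀A, hw₀V⟩ : ∃ w₀, w₀ ∈ closure V ∧ w₀ ∈ A ∧ w₀ ∉ V := by
    by_contra! hcon
    have hsub : A ⊆ V := (isPreconnected_halfPlane_diff_singleton hσ α
      ).subset_of_closure_inter_subset hV hAV fun w hw => hcon w hw.1 hw.2
    obtain ⟨η, hη, hatt⟩ := exists_ball_tendsto_iterate hαq
    obtain ⟨x, ⟨hx1, hx2⟩, hx3⟩ := (dense_compl_singleton α).inter_open_nonempty _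
      (hTo.inter (isOpen_ball (x := α) (ε := η))) ⟨α, hα, mem_ball_self hη⟩
    have h1 : Tendsto (fun j => (conjHalley r)^[N j] x) atTop (𝓝 x) :=
      (hlimV x (hsub ⟨hx1, hx3⟩)).comp (tendsto_id.prodMk (tendsto_const_nhds (x := x)))
    exact hx3 (tendsto_nhds_unique h1 ((hatt x hx2).comp hN))
  obtain ⟨ε, hε, hεA⟩ := Metric.isOpen_iff.1 hAo w₀ hw₀A
  obtain ⟨ρ, hρ⟩ := exists_norm_le_norm_conjHalley r
  obtain ⟨δ, hδ, M, hM⟩ := (isProperHolomorphic_conjHalley r).exists_ball_iterates_bounded hρ hε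
    (fun n w hw hwD => by
      obtain ⟨h1, h2⟩ := hεA hwD
      refine deriv_iterate_conjHalley_ne_zero hw (fun h0 => ?_) fun h0 => h2 (hαu _ h1 h0)
      rw [mem_ofPred_eq, h0, mul_zero] at h1
      exact lt_irrefl _ h1) hV
    (by
      rw [inter_comm]
      exact mem_closure_iff.1 hw₀c _ isOpen_ball (mem_ball_self hε))
    hN (fun j => hreg _) hlimV
  have hclosure : rootChart r w₀ ∈ closure U :=
    continuous_rootChart.closure_preimage_subset U hw₀c
  exact hw₀V (hrot.isFatouComponent.mem_of_mem_closure (rootChart_mem_fatouSet hδ hM) hclosure)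

theorem exists_real_root (b : ℝ) : ∃ r : ℝ, b = -(r ^ 3 + 6 * r) := by
  have hc : Continuous fun x : ℝ => x ^ 3 + 6 * x + b := by fun_prop
  have hab : -(|b| + 1) ≤ |b| + 1 := by linarith [abs_nonneg b]
  have h0 := neg_abs_le b
  have h1 := le_abs_self b
  have h2 : 0 ≤ (|b| + 1) ^ 3 := by positivity
  obtain ⟨x, -, hx⟩ := intermediate_value_Icc hab hc.continuousOn
    (show (0 : ℝ) ∈ Icc _ _ from ⟨by nlinarith, by nlinarith⟩)
  exact ⟨x, by simp only at hx; linarith⟩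

end HalleyDynamics

theorem mainTheorem5 (b : ℝ) :
    ¬ ∃ U : Set HalleyDynamics.Sphere,
      HalleyDynamics.IsRotationDomain
        (HalleyDynamics.ratMap (HalleyDynamics.halley (HalleyDynamics.cubic (b : ℂ)))) U := by
  rintro ⟨U, hU⟩
  obtain ⟨r, rfl⟩ := HalleyDynamics.exists_real_root b
  refine HalleyDynamics.not_isRotationDomain_halleyMap r U ?_
  have hb : ((-(r ^ 3 + 6 * r) : ℝ) : ℂ) = -((r : ℂ) ^ 3 + 6 * r) := by push_cast; ring
  rwa [hb] at hU
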